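/- Let $\Bbbk$ be a field; all categories, functors and actions below are $\Bbbk$-linear (bilinear in two variables). Let $\mathcal C$ be an abelian monoidal category and $\mathcal M$ an abelian left $\mathcal C$-module category whose action $\triangleright:\mathcal C\times\mathcal M\to\mathcal M$ is right exact in each variable, that is, preserves finite colimits in each variable. Let $(T,\mu,\eta)$ be a right exact lax $\mathcal C$-module monad on $\mathcal M$: a monad preserving finite colimits, with natural morphisms $(T_a)_{V,X}: V\triangleright T(X)\to T(V\triangleright X)$ making $T$ a lax $\mathcal C$-module functor such that $\mu$ and $\eta$ are $\mathcal C$-module transformations. Let $\mathrm{EM}(T)$ be the Eilenberg–Moore category. For $V\in\mathcal C$ and $M=(M,\nabla_M)\in\mathrm{EM}(T)$ let $V\blacktriangleright M$ be the coequalizer in $\mathrm{EM}(T)$ (the Linton coequalizer) of the two morphisms $$T(V\triangleright\nabla_M),\quad \mu_{V\triangleright M}\circ T\big((T_a)_{V,M}\big)\;:\;T(V\triangleright T(M))\rightrightarrows T(V\triangleright M),$$ let $q_{V,M}:T(V\triangleright M)\to V\blacktriangleright M$ be the quotient morphism, and put $\pi_{V,M}:=q_{V,M}\circ\eta_{V\triangleright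 M}: V\triangleright M\to V\blacktriangleright M$ (a morphism of $\mathcal M$). By functoriality of coequalizers $\blacktriangleright$ is a functor $\mathcal C\times\mathrm{EM}(T)\to\mathrm{EM}(T)$. Let $\mathrm{Kl}(T)$ be the Kleisli category, with the $\mathcal C$-module structure for which $V$ sends $X$ to $V\triangleright X$ and a morphism $X\to Y$ of $\mathrm{Kl}(T)$, given by $g:X\to T(Y)$, to the one given by $(T_a)_{V,Y}\circ(V\triangleright g)$, and for which the free functor $\mathcal M\to\mathrm{Kl}(T)$ is a strict $\mathcal C$-module functor. Let $\iota:\mathrm{Kl}(T)\hookrightarrow\mathrm{EM}(T)$ be the canonical inclusion $X\mapsto(T(X),\mu_X)$, $g\mapsto\mu_Y\circ T(g)$. Then: 1. The functor $\blacktriangleright$ is $\Bbbk$-linear in each variable and is the action functor of a left $\mathcal C$-module category structure on $\mathrm{EM}(T)$ (natural associator $a^{\blacktriangleright}$ and unitor $l^{\blacktriangleright}$ satisfying the pentagon and triangle axioms). These are compatible with the associator $a$ and the unitor $l$ of $\mathcal M$: $$a^{\blacktriangleright}_{V,W,M}\circ\pi_{V\otimes W,M}=\pi_{V,W\blacktriangleright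 M}\circ(V\triangleright\pi_{W,M})\circ a_{V,W,M},\qquad l^{\blacktriangleright}_M\circ\pi_{\mathbb 1,M}=l_M .$$ 2. For this structure, $\iota$ is a ($\Bbbk$-linear) strong $\mathcal C$-module functor, with structure isomorphism $(\iota_a)_{V,X}:V\blacktriangleright\iota(X)\to\iota(V\triangleright X)$ satisfying $(\iota_a)_{V,X}\circ\pi_{V,\iota(X)}=(T_a)_{V,X}$. -/

import Mathlib

open CategoryTheory CategoryTheory.Limits CategoryTheory.MonoidalCategory
open CategoryTheory.MonoidalCategory.MonoidalLeftAction

universe w v₁ v₂ u₁ u₂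

/-- A lax `C`-module monad on a left `C`-module category `D`: a monad `T` together with a lax
`C`-module structure `c ⊙ₗ T d ⟶ T (c ⊙ₗ d)` on its underlying functor, such that the unit
`𝟭 D ⟶ T` and the multiplication `T ⋙ T ⟶ T` are `C`-module transformations. Here `𝟭 D` carries
the identity lax structure, and `T ⋙ T` the composite
`c ⊙ₗ T T d ⟶ T (c ⊙ₗ T d) ⟶ T T (c ⊙ₗ d)`. -/
class LaxModuleMonad (C : Type u₁) [Category.{v₁} C] [MonoidalCategory C]
    {D : Type u₂} [Category.{v₂} D] [MonoidalLeftAction C D] (T : Monad D)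
    extends Functor.LaxLeftLinear T.toFunctor C where
  unit_transformation (c : C) (d : D) :
    c ⊴ₗ T.η.app d ≫ μₗ c d = T.η.app (c ⊙ₗ d)
  mul_transformation (c : C) (d : D) :
    c ⊴ₗ T.μ.app d ≫ μₗ c d = μₗ c (T.obj d) ≫ T.map (μₗ c d) ≫ T.μ.app (c ⊙ₗ d)

/-- A left `C`-module category structure on `D` whose action functor is a prescribed bifunctor
`A : C ⥤ D ⥤ D`: a natural associator and a natural unitor satisfying the pentagon and the two
triangle axioms. -/
structure ModuleStructure {C : Type u₁} [Category.{v₁} C] [MonoidalCategory C]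
    {D : Type u₂} [Category.{v₂} D] (A : C ⥤ D ⥤ D) where
  assocIso (c c' : C) (d : D) : (A.obj (c ⊗ c')).obj d ≅ (A.obj c).obj ((A.obj c').obj d)
  unitIso (d : D) : (A.obj (𝟙_ C)).obj d ≅ d
  assoc_naturality {c₁ c₂ c₁' c₂' : C} {d₁ d₂ : D} (f : c₁ ⟶ c₂) (g : c₁' ⟶ c₂') (h : d₁ ⟶ d₂) :
    ((A.map (f ⊗ₘ g)).app d₁ ≫ (A.obj (c₂ ⊗ c₂')).map h) ≫ (assocIso c₂ c₂' d₂).hom =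
      (assocIso c₁ c₁' d₁).hom ≫
        (A.map f).app ((A.obj c₁').obj d₁) ≫
          (A.obj c₂).map ((A.map g).app d₁ ≫ (A.obj c₂').map h)
  unit_naturality {d d' : D} (f : d ⟶ d') :
    (unitIso d).hom ≫ f = (A.obj (𝟙_ C)).map f ≫ (unitIso d').hom
  pentagon (c₁ c₂ c₃ : C) (d : D) :
    (A.map (α_ c₁ c₂ c₃).hom).app d ≫ (assocIso c₁ (c₂ ⊗ c₃) d).hom ≫
        (A.obj c₁).map (assocIso c₂ c₃ d).hom =
      (assocIso (c₁ ⊗ c₂) c₃ d).hom ≫ (assocIso c₁ c₂ ((A.obj c₃).obj d)).hom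
  left_triangle (c : C) (d : D) :
    (A.map (λ_ c).hom).app d = (assocIso (𝟙_ C) c d).hom ≫ (unitIso ((A.obj c).obj d)).hom
  right_triangle (c : C) (d : D) :
    (A.map (ρ_ c).hom).app d = (assocIso c (𝟙_ C) d).hom ≫ (A.obj c).map (unitIso d).hom

/-- The left action determined by a module structure on a bifunctor. -/
@[reducible]
def ModuleStructure.toAction {C : Type u₁} [Category.{v₁} C] [MonoidalCategory C]
    {D : Type u₂} [Category.{v₂} D] {A : C ⥤ D ⥤ D} (S : ModuleStructure A) :
    MonoidalLeftAction C D where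
  actionObj c d := (A.obj c).obj d
  actionHomLeft f d := (A.map f).app d
  actionHomRight c _ _ f := (A.obj c).map f
  actionAssocIso := S.assocIso
  actionUnitIso := S.unitIso
  actionHom_comp f₁ f₂ g₁ g₂ := by simp
  actionAssocIso_hom_naturality f g h := S.assoc_naturality f g h
  actionUnitIso_hom_naturality f := S.unit_naturality f
  whiskerLeft_actionHomLeft c _ _ f d := by
    have := S.assoc_naturality (𝟙 c) f (𝟙 d)
    rw [← Category.assoc, Iso.eq_comp_inv]
    simpa using this
  whiskerRight_actionHomLeft c f d := by
    have := S.assoc_naturality f (𝟙 c) (𝟙 d)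
    rw [← Category.assoc, Iso.eq_comp_inv]
    simpa using this
  associator_actionHom := S.pentagon
  leftUnitor_actionHom := S.left_triangle
  rightUnitor_actionHom := S.right_triangle

section Linear

variable (k : Type w) [Field k] {D : Type u₂} [Category.{v₂} D] [Preadditive D]
  [Linear k D] (T : Monad D) [T.toFunctor.Additive]

/-- The `k`-linear structure of the Eilenberg–Moore category of a `k`-linear monad, computed on
underlying morphisms. -/
instance emLinear [T.toFunctor.Linear k] : Linear k T.Algebra where
  homModule X Y :=
    { smul r f :=
        { f := r • f.f
          h := by rw [Functor.map_smul, Linear.smul_comp, f.h, Linear.comp_smul] }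
      one_smul f := Monad.Algebra.Hom.ext (one_smul k f.f)
      mul_smul r s f := Monad.Algebra.Hom.ext (mul_smul r s f.f)
      smul_zero r := Monad.Algebra.Hom.ext (smul_zero r)
      smul_add r f g := Monad.Algebra.Hom.ext (smul_add r f.f g.f)
      add_smul r s f := Monad.Algebra.Hom.ext (add_smul r s f.f)
      zero_smul f := Monad.Algebra.Hom.ext (zero_smul k f.f) }
  smul_comp _ _ _ r f g := Monad.Algebra.Hom.ext (Linear.smul_comp _ _ _ r f.f g.f)
  comp_smul _ _ _ f r g := Monad.Algebra.Hom.ext (Linear.comp_smul _ _ _ f.f r g.f)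

/-- The identification of a Kleisli hom `X ⟶ Y` with the hom `X ⟶ T Y` of the base category. -/
def kleisliHomEquiv {D : Type u₂} [Category.{v₂} D] {T : Monad D} (X Y : Kleisli T) :
    (X ⟶ Y) ≃ (X.of ⟶ T.obj Y.of) where
  toFun f := f.of
  invFun f := ⟨f⟩

/-- The preadditive structure of the Kleisli category, `Kl(T)(X, Y) = D(X, T Y)`. -/
instance kleisliPreadditive : Preadditive (Kleisli T) where
  homGroup X Y := (kleisliHomEquiv X Y).addCommGroup
  add_comp X Y Z f g h := Kleisli.hom_ext
    (Preadditive.add_comp _ _ _ f.of g.of (T.map h.of ≫ T.μ.app Z.of))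
  comp_add X Y Z f g h := Kleisli.hom_ext (by
    change f.of ≫ T.map (g.of + h.of) ≫ T.μ.app Z.of =
      f.of ≫ T.map g.of ≫ T.μ.app Z.of + f.of ≫ T.map h.of ≫ T.μ.app Z.of
    simp [Functor.map_add])

/-- The `k`-linear structure of the Kleisli category, `Kl(T)(X, Y) = D(X, T Y)`. -/
instance kleisliLinear [T.toFunctor.Linear k] : Linear k (Kleisli T) where
  homModule X Y := (kleisliHomEquiv X Y).module k
  smul_comp X Y Z r f g := Kleisli.hom_ext
    (Linear.smul_comp _ _ _ r f.of (T.map g.of ≫ T.μ.app Z.of))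
  comp_smul X Y Z f r g := Kleisli.hom_ext (by
    change f.of ≫ T.map (r • g.of) ≫ T.μ.app Z.of = r • (f.of ≫ T.map g.of ≫ T.μ.app Z.of)
    simp [Functor.map_smul])

end Linear

/-- The canonical inclusion `ι : Kl(T) ⥤ EM(T)`, sending `X` to the free module `(T X, μ_X)` and
`f : X ⟶ T Y` to `μ_Y ∘ T f`. -/
@[simps]
def kleisliInclusion {D : Type u₂} [Category.{v₂} D] (T : Monad D) : Kleisli T ⥤ T.Algebra where
  obj X := T.free.obj X.of
  map {X Y} f :=
    { f := T.map f.of ≫ T.μ.app Y.of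
      h := by
        change T.map (T.map f.of ≫ T.μ.app Y.of) ≫ T.μ.app Y.of =
          T.μ.app X.of ≫ T.map f.of ≫ T.μ.app Y.of
        rw [T.map_comp, Category.assoc, T.assoc]
        rw [T.mu_naturality_assoc] }
  map_id X := by
    ext
    exact T.right_unit X.of
  map_comp {X Y Z} f g := by
    ext
    change T.map (f.of ≫ T.map g.of ≫ T.μ.app Z.of) ≫ T.μ.app Z.of =
      (T.map f.of ≫ T.μ.app Y.of) ≫ T.map g.of ≫ T.μ.app Z.of
    rw [T.map_comp, T.map_comp, Category.assoc, Category.assoc, Category.assoc, T.assoc]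
    rw [T.mu_naturality_assoc]

section Action

variable {C : Type u₁} [Category.{v₁} C] [MonoidalCategory C]
  {D : Type u₂} [Category.{v₂} D] [MonoidalLeftAction C D]

open Functor.LaxLeftLinear

/-- The free functor `D ⥤ Kl(T)` on morphisms. -/
def kleisliPure (T : Monad D) {X Y : D} (f : X ⟶ Y) : Kleisli.mk T X ⟶ Kleisli.mk T Y :=
  (Kleisli.Adjunction.toKleisli T).map f

theorem kleisliPure_comp (T : Monad D) {X Y Z : D} (f : X ⟶ Y) (g : Y ⟶ Z) :
    kleisliPure T (f ≫ g) = kleisliPure T f ≫ kleisliPure T g :=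
  (Kleisli.Adjunction.toKleisli T).map_comp f g

/-- The free functor `D ⥤ Kl(T)` on isomorphisms. -/
@[simps]
def kleisliPureIso (T : Monad D) {X Y : D} (f : X ≅ Y) : Kleisli.mk T X ≅ Kleisli.mk T Y where
  hom := kleisliPure T f.hom
  inv := kleisliPure T f.inv
  hom_inv_id := ((Kleisli.Adjunction.toKleisli T).mapIso f).hom_inv_id
  inv_hom_id := ((Kleisli.Adjunction.toKleisli T).mapIso f).inv_hom_id

theorem toKleisli_comp (T : Monad D) {X Y : D} {Z : Kleisli T} (f : X ⟶ Y) (g : .mk T Y ⟶ Z) :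
    kleisliPure T f ≫ g = ⟨f ≫ g.of⟩ := by
  apply Kleisli.hom_ext
  change (f ≫ T.η.app Y) ≫ T.map g.of ≫ T.μ.app Z.of = f ≫ g.of
  have h {Z : D} (g : Y ⟶ T.obj Z) : T.η.app Y ≫ T.map g ≫ T.μ.app Z = g := by
    refine (Monad.unit_naturality_assoc D T g (T.μ.app Z)).symm.trans ?_
    rw [T.left_unit]
    exact Category.comp_id g
  rw [Category.assoc, h g.of]

theorem comp_toKleisli (T : Monad D) {X : Kleisli T} {Y Z : D} (g : X ⟶ .mk T Y) (f : Y ⟶ Z) :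
    g ≫ kleisliPure T f = ⟨g.of ≫ T.map f⟩ := by
  apply Kleisli.hom_ext
  change g.of ≫ T.map (f ≫ T.η.app Z) ≫ T.μ.app Z = g.of ≫ T.map f
  rw [T.map_comp, Category.assoc, T.right_unit]
  exact congrArg (g.of ≫ ·) (Category.comp_id _)

/-- The action of `c : C` on Kleisli morphisms: `g : X ⟶ T Y` is sent to
`c ⊙ₗ X ⟶ c ⊙ₗ T Y ⟶ T (c ⊙ₗ Y)`. -/
def kleisliActionMap {T : Monad D} [LaxModuleMonad C T] (c : C) {X Y : Kleisli T} (g : X ⟶ Y) :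
    Kleisli.mk T (c ⊙ₗ X.of) ⟶ Kleisli.mk T (c ⊙ₗ Y.of) :=
  ⟨c ⊴ₗ g.of ≫ μₗ T.toFunctor c Y.of⟩

theorem kleisliActionMap_toKleisli (T : Monad D) [LaxModuleMonad C T] (c : C) {X Y : D}
    (f : X ⟶ Y) :
    kleisliActionMap c (kleisliPure T f) =
      kleisliPure T (c ⊴ₗ f) := by
  apply Kleisli.hom_ext
  change c ⊴ₗ (f ≫ T.η.app Y) ≫ μₗ T.toFunctor c Y = c ⊴ₗ f ≫ T.η.app (c ⊙ₗ Y)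
  rw [actionHomRight_comp, Category.assoc, LaxModuleMonad.unit_transformation]

theorem kleisliActionMap_comp {T : Monad D} [LaxModuleMonad C T] (c : C) {X Y Z : Kleisli T}
    (g : X ⟶ Y) (h : Y ⟶ Z) :
    kleisliActionMap c (g ≫ h) = kleisliActionMap c g ≫ kleisliActionMap c h := by
  apply Kleisli.hom_ext
  change c ⊴ₗ (g.of ≫ T.map h.of ≫ T.μ.app Z.of) ≫ μₗ T.toFunctor c Z.of =
    (c ⊴ₗ g.of ≫ μₗ T.toFunctor c Y.of) ≫
      T.map (c ⊴ₗ h.of ≫ μₗ T.toFunctor c Z.of) ≫ T.μ.app (c ⊙ₗ Z.of)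
  rw [actionHomRight_comp, actionHomRight_comp, Category.assoc, Category.assoc,
    LaxModuleMonad.mul_transformation, μₗ_naturality_right_assoc, T.map_comp, Category.assoc,
    Category.assoc]

theorem kleisliActionMap_exchange {T : Monad D} [LaxModuleMonad C T] {c c' : C} (f : c ⟶ c')
    {X Y : Kleisli T} (g : X ⟶ Y) :
    kleisliActionMap c g ≫ kleisliPure T (f ⊵ₗ Y.of) =
      kleisliPure T (f ⊵ₗ X.of) ≫ kleisliActionMap c' g := by
  rw [toKleisli_comp, comp_toKleisli]
  apply Kleisli.hom_ext
  change (c ⊴ₗ g.of ≫ μₗ T.toFunctor c Y.of) ≫ T.map (f ⊵ₗ Y.of) =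
    f ⊵ₗ X.of ≫ c' ⊴ₗ g.of ≫ μₗ T.toFunctor c' Y.of
  rw [Category.assoc, ← μₗ_naturality_left, action_exchange_assoc]

theorem kleisliActionMap_assoc {T : Monad D} [LaxModuleMonad C T] (c c' : C)
    {X Y : Kleisli T} (g : X ⟶ Y) :
    kleisliActionMap (c ⊗ c') g ≫ kleisliPure T (αₗ c c' Y.of).hom =
      kleisliPure T (αₗ c c' X.of).hom ≫
        kleisliActionMap c (kleisliActionMap c' g) := by
  rw [toKleisli_comp, comp_toKleisli]
  apply Kleisli.hom_ext
  change ((c ⊗ c') ⊴ₗ g.of ≫ μₗ T.toFunctor (c ⊗ c') Y.of) ≫ T.map (αₗ c c' Y.of).hom =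
    (αₗ c c' X.of).hom ≫ c ⊴ₗ (c' ⊴ₗ g.of ≫ μₗ T.toFunctor c' Y.of) ≫
      μₗ T.toFunctor c (c' ⊙ₗ Y.of)
  rw [Category.assoc, μₗ_associativity, tensor_actionHomRight]
  simp

theorem kleisliActionMap_unit {T : Monad D} [LaxModuleMonad C T] {X Y : Kleisli T} (g : X ⟶ Y) :
    kleisliActionMap (𝟙_ C) g ≫ kleisliPure T (λₗ Y.of).hom =
      kleisliPure T (λₗ[C] X.of).hom ≫ g := by
  rw [toKleisli_comp, comp_toKleisli]
  apply Kleisli.hom_ext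
  change ((𝟙_ C) ⊴ₗ g.of ≫ μₗ T.toFunctor (𝟙_ C) Y.of) ≫ T.map (λₗ Y.of).hom =
    (λₗ[C] X.of).hom ≫ g.of
  rw [Category.assoc, ← μₗ_unitality, ← actionUnitIso_hom_naturality]

/-- The `C`-module category structure on the Kleisli category of a lax `C`-module monad: on
objects it is the action on `D`, on Kleisli morphisms it is `kleisliActionMap`, and everything
else is the image of the structure of `D` under the free functor `D ⥤ Kl(T)`, which is thus a
strict `C`-module functor. -/
instance kleisliAction (T : Monad D) [LaxModuleMonad C T] : MonoidalLeftAction C (Kleisli T) where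
  actionObj c X := .mk T (c ⊙ₗ X.of)
  actionHomLeft f X := kleisliPure T (f ⊵ₗ X.of)
  actionHomRight c _ _ g := kleisliActionMap c g
  actionAssocIso c c' X := kleisliPureIso T (αₗ c c' X.of)
  actionUnitIso X := kleisliPureIso T (λₗ X.of)
  actionHom_def _ _ := rfl
  actionHomRight_id c X := by
    apply Kleisli.hom_ext
    exact LaxModuleMonad.unit_transformation c X.of
  id_actionHomLeft c X := by
    rw [id_actionHomLeft]
    exact (Kleisli.Adjunction.toKleisli T).map_id _
  actionHom_comp {c c' c'' X X' X''} f₁ f₂ g₁ g₂ := by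
    rw [comp_actionHomLeft, kleisliPure_comp, kleisliActionMap_comp, Category.assoc,
      Category.assoc]
    congr 1
    rw [← Category.assoc, ← kleisliActionMap_exchange, Category.assoc]
  actionAssocIso_hom_naturality {c₁ c₂ c₃ c₄ X Y} f g h := by
    dsimp only [kleisliPureIso]
    rw [kleisliActionMap_comp, Category.assoc, kleisliActionMap_assoc,
      kleisliActionMap_toKleisli, ← Category.assoc, ← Category.assoc, ← Category.assoc,
      ← kleisliPure_comp, ← kleisliPure_comp, ← kleisliPure_comp]
    congr 2
    have := actionAssocIso_hom_naturality f g (𝟙 X.of)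
    simpa only [actionHom_id, actionHom_def, actionHomRight_id, Category.comp_id,
      Category.assoc] using this
  actionUnitIso_hom_naturality {X Y} f := (kleisliActionMap_unit f).symm
  whiskerLeft_actionHomLeft c {c' c''} f X := by
    rw [kleisliActionMap_toKleisli]
    change kleisliPure T _ = kleisliPure T _ ≫ kleisliPure T _ ≫ kleisliPure T _
    rw [whiskerLeft_actionHomLeft, kleisliPure_comp, kleisliPure_comp]
  whiskerRight_actionHomLeft {c c'} c'' f X := by
    change kleisliPure T _ = kleisliPure T _ ≫ kleisliPure T _ ≫ kleisliPure T _
    rw [whiskerRight_actionHomLeft, kleisliPure_comp, kleisliPure_comp]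
  associator_actionHom c₁ c₂ c₃ X := by
    dsimp only [kleisliPureIso]
    rw [kleisliActionMap_toKleisli]
    rw [← kleisliPure_comp, ← kleisliPure_comp, ← kleisliPure_comp, associator_actionHom]
  leftUnitor_actionHom c X := by
    change kleisliPure T _ = kleisliPure T _ ≫ kleisliPure T _
    rw [leftUnitor_actionHom, kleisliPure_comp]
  rightUnitor_actionHom c X := by
    dsimp only [kleisliPureIso]
    rw [kleisliActionMap_toKleisli]
    change kleisliPure T _ = kleisliPure T _ ≫ kleisliPure T _
    rw [rightUnitor_actionHom, kleisliPure_comp]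

variable (T : Monad D)

/-- The first morphism `T (V ▷ ∇_M) : T (V ▷ T M) ⟶ T (V ▷ M)` of the Linton pair. -/
def lintonFst (V : C) (M : T.Algebra) :
    T.free.obj (V ⊙ₗ T.obj M.A) ⟶ T.free.obj (V ⊙ₗ M.A) :=
  T.free.map (V ⊴ₗ M.a)

theorem lintonFst_naturality {V W : C} {M N : T.Algebra} (f : V ⟶ W) (g : M ⟶ N) :
    lintonFst T V M ≫ T.free.map (f ⊙ₗₘ g.f) =
      T.free.map (f ⊙ₗₘ T.map g.f) ≫ lintonFst T W N := by
  have h : V ⊴ₗ M.a ≫ (f ⊙ₗₘ g.f) = (f ⊙ₗₘ T.map g.f) ≫ W ⊴ₗ N.a := by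
    rw [← id_actionHom, ← id_actionHom, ← actionHom_comp, ← actionHom_comp, g.h]
    simp
  rw [lintonFst, lintonFst, ← T.free.map_comp, ← T.free.map_comp, h]

variable [LaxModuleMonad C T]

/-- The second morphism `μ_{V ▷ M} ∘ T (T_a) : T (V ▷ T M) ⟶ T (V ▷ M)` of the Linton pair. -/
def lintonSnd (V : C) (M : T.Algebra) :
    T.free.obj (V ⊙ₗ T.obj M.A) ⟶ T.free.obj (V ⊙ₗ M.A) where
  f := T.map (μₗ T.toFunctor V M.A) ≫ T.μ.app (V ⊙ₗ M.A)
  h := by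
    change T.map (T.map (μₗ T.toFunctor V M.A) ≫ T.μ.app (V ⊙ₗ M.A)) ≫ T.μ.app (V ⊙ₗ M.A) =
      T.μ.app (V ⊙ₗ T.obj M.A) ≫ T.map (μₗ T.toFunctor V M.A) ≫ T.μ.app (V ⊙ₗ M.A)
    rw [T.map_comp, Category.assoc, T.assoc]
    rw [T.mu_naturality_assoc]

theorem lax_naturality {V W : C} {X Y : D} (f : V ⟶ W) (g : X ⟶ Y) :
    μₗ T.toFunctor V X ≫ T.map (f ⊙ₗₘ g) = (f ⊙ₗₘ T.map g) ≫ μₗ T.toFunctor W Y := by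
  rw [actionHom_def, actionHom_def, T.map_comp, ← Category.assoc, ← μₗ_naturality_left,
    Category.assoc, ← μₗ_naturality_right, Category.assoc]

theorem lintonSnd_naturality {V W : C} {M N : T.Algebra} (f : V ⟶ W) (g : M ⟶ N) :
    lintonSnd T V M ≫ T.free.map (f ⊙ₗₘ g.f) =
      T.free.map (f ⊙ₗₘ T.map g.f) ≫ lintonSnd T W N := by
  ext
  change (T.map (μₗ T.toFunctor V M.A) ≫ T.μ.app (V ⊙ₗ M.A)) ≫ T.map (f ⊙ₗₘ g.f) =
    T.map (f ⊙ₗₘ T.map g.f) ≫ T.map (μₗ T.toFunctor W N.A) ≫ T.μ.app (W ⊙ₗ N.A)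
  rw [Category.assoc, ← T.mu_naturality, ← Category.assoc, ← T.map_comp, lax_naturality,
    T.map_comp, Category.assoc]

variable [HasCoequalizers D] [PreservesFiniteColimits T.toFunctor]

/-- Coequalizers exist in the Eilenberg–Moore category of a right exact monad. -/
instance emHasCoequalizers : HasCoequalizers T.Algebra :=
  hasColimitsOfShape_of_hasColimitsOfShape_createsColimitsOfShape T.forget

/-- The Linton coequalizer `V ▶ M`, formed in the Eilenberg–Moore category. -/
noncomputable def lintonObj (V : C) (M : T.Algebra) : T.Algebra :=
  coequalizer (lintonFst T V M) (lintonSnd T V M)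

/-- The quotient map `T (V ▷ M) ⟶ V ▶ M`. -/
noncomputable def lintonQuot (V : C) (M : T.Algebra) :
    T.free.obj (V ⊙ₗ M.A) ⟶ lintonObj T V M :=
  coequalizer.π (lintonFst T V M) (lintonSnd T V M)

theorem lintonQuot_condition (V : C) (M : T.Algebra) :
    lintonFst T V M ≫ lintonQuot T V M = lintonSnd T V M ≫ lintonQuot T V M :=
  coequalizer.condition _ _

/-- Functoriality of the Linton coequalizer: the morphism `V ▶ M ⟶ W ▶ N` of coequalizers induced
by `T (f ▷ g)`. -/
noncomputable def lintonMap {V W : C} {M N : T.Algebra} (f : V ⟶ W) (g : M ⟶ N) :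
    lintonObj T V M ⟶ lintonObj T W N :=
  coequalizer.desc (T.free.map (f ⊙ₗₘ g.f) ≫ lintonQuot T W N) (by
    rw [← Category.assoc, ← Category.assoc, lintonFst_naturality, lintonSnd_naturality,
      Category.assoc, Category.assoc, lintonQuot_condition])

theorem lintonQuot_map {V W : C} {M N : T.Algebra} (f : V ⟶ W) (g : M ⟶ N) :
    lintonQuot T V M ≫ lintonMap T f g = T.free.map (f ⊙ₗₘ g.f) ≫ lintonQuot T W N :=
  coequalizer.π_desc _ _

theorem lintonObj_hom_ext {V : C} {M N : T.Algebra} {f g : lintonObj T V M ⟶ N}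
    (h : lintonQuot T V M ≫ f = lintonQuot T V M ≫ g) : f = g :=
  coequalizer.hom_ext h

theorem lintonMap_id (V : C) (M : T.Algebra) :
    lintonMap T (𝟙 V) (𝟙 M) = 𝟙 (lintonObj T V M) := by
  apply lintonObj_hom_ext
  rw [lintonQuot_map]
  simp

theorem lintonMap_comp {U V W : C} {L M N : T.Algebra} (f : U ⟶ V) (f' : V ⟶ W)
    (g : L ⟶ M) (g' : M ⟶ N) :
    lintonMap T (f ≫ f') (g ≫ g') = lintonMap T f g ≫ lintonMap T f' g' := by
  apply lintonObj_hom_ext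
  rw [lintonQuot_map, ← Category.assoc, lintonQuot_map, Category.assoc, lintonQuot_map]
  simp

variable (C) in
/-- The bifunctor `- ▶ = : C × EM(T) ⥤ EM(T)` of Linton coequalizers, in curried form. -/
noncomputable def lintonAction : C ⥤ T.Algebra ⥤ T.Algebra where
  obj V :=
    { obj M := lintonObj T V M
      map g := lintonMap T (𝟙 V) g
      map_id M := lintonMap_id T V M
      map_comp g g' := by rw [← lintonMap_comp, Category.comp_id] }
  map f :=
    { app M := lintonMap T f (𝟙 M)
      naturality M N g := by
        change lintonMap T _ _ ≫ lintonMap T _ _ = lintonMap T _ _ ≫ lintonMap T _ _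
        rw [← lintonMap_comp, ← lintonMap_comp]
        simp }
  map_id V := by ext M : 2; exact lintonMap_id T V M
  map_comp f g := by
    ext M : 2
    change lintonMap T _ _ = lintonMap T _ _ ≫ lintonMap T _ _
    rw [← lintonMap_comp, Category.comp_id]

/-- The universal morphism `V ▷ M ⟶ V ▶ M` of `D` that corresponds to the quotient map
`T (V ▷ M) ⟶ V ▶ M` of `EM(T)` under the free-forgetful adjunction. -/
noncomputable def lintonUnit (V : C) (M : T.Algebra) :
    V ⊙ₗ M.A ⟶ (((lintonAction C T).obj V).obj M).A :=
  T.η.app (V ⊙ₗ M.A) ≫ (lintonQuot T V M).f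

end Action

/-! The Linton coequalizer is handled through its universal property, as a tensor product over a
ring is. Transposing along the free-forgetful adjunction, algebra morphisms `V ▶ M ⟶ N` are the same
as balanced morphisms `V ▷ M ⟶ N` of `D`, with π the universal one (`lintonProj_balanced`,
`lintonDesc`, `lintonProj_hom_ext`).

The associator compares two objects representing the same functor, that of bibalanced morphisms `V ▷
(W ▷ M) ⟶ N`. For `(V ⊗ W) ▶ M` this is the associativity of the lax structure, which carries
balanced to bibalanced morphisms across `αₗ`. For `V ▶ (W ▶ M)` right exactness enters: `T` and `V ▷
-` preserve the coequalizer defining `W ▶ M`, so a bibalanced morphism extends along `V ▷ T (W ▷ M)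
⟶ V ▷ (W ▶ M)`, and the extension is balanced (`IsBibalanced.exists_desc`,
`lintonProj_lintonProj_hom_ext`). The unitor is induced by `λₗ`. Each coherence or linearity
identity is tested after composing with π, where it becomes the corresponding identity in `D`.

For a free algebra, a balanced morphism out of `V ▷ T X` is determined by its restriction along `V ▷
η_X`, and that restriction is arbitrary. Hence `V ▶ T X ≅ T (V ▷ X)`, with the lax structure of `T`
corresponding to π. The axioms for ι to be a module functor are then those of the lax structure. -/

/-! ### Balanced and bibalanced morphisms. -/

section Balanced

variable {C : Type u₁} [Category.{v₁} C] [MonoidalCategory C]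
  {D : Type u₂} [Category.{v₂} D] [MonoidalLeftAction C D]
  (T : Monad D) [LaxModuleMonad C T]

open Functor.LaxLeftLinear

/-- A morphism `g : V ▷ M ⟶ N` of the base category is balanced if it is compatible with the
`T`-algebra structures of `M` and `N`. Balanced morphisms are the ones that factor, uniquely,
through the Linton coequalizer `V ▶ M`. -/
def IsBalanced (V : C) (M N : T.Algebra) (g : V ⊙ₗ M.A ⟶ N.A) : Prop :=
  V ⊴ₗ M.a ≫ g = μₗ T.toFunctor V M.A ≫ T.map g ≫ N.a

variable {T}

theorem IsBalanced.comp {V : C} {M N N' : T.Algebra} {g : V ⊙ₗ M.A ⟶ N.A}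
    (hg : IsBalanced T V M N g) (f : N ⟶ N') : IsBalanced T V M N' (g ≫ f.f) := by
  unfold IsBalanced at *
  rw [← Category.assoc, hg, T.map_comp]
  simp [f.h]

/-- Unitality of the lax structure and naturality of `λₗ`. This is what lets `λₗ` descend to the
unitor. -/
theorem isBalanced_unit (M : T.Algebra) : IsBalanced T (𝟙_ C) M M (λₗ M.A).hom := by
  unfold IsBalanced
  rw [← Category.assoc, ← μₗ_unitality, actionUnitIso_hom_naturality]

/-- The lax structure morphism is balanced as a morphism `V ▷ T X ⟶ T (V ▷ X)` between free
algebras. -/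
theorem isBalanced_lax (V : C) (X : D) :
    IsBalanced T V (T.free.obj X) (T.free.obj (V ⊙ₗ X)) (μₗ T.toFunctor V X) :=
  LaxModuleMonad.mul_transformation V X

/-- The analogue of `IsBalanced` for morphisms `V ▷ (W ▷ M) ⟶ N`. -/
def IsBibalanced (V W : C) (M N : T.Algebra) (h : V ⊙ₗ (W ⊙ₗ M.A) ⟶ N.A) : Prop :=
  V ⊴ₗ (W ⊴ₗ M.a) ≫ h =
    V ⊴ₗ μₗ T.toFunctor W M.A ≫ μₗ T.toFunctor V (W ⊙ₗ M.A) ≫ T.map h ≫ N.a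

/-- Associativity of the lax structure is exactly the translation between the two conditions. With
the converse below, composition with `αₗ` is a bijection between balanced and bibalanced morphisms.
-/
theorem IsBalanced.bibalanced {V W : C} {M N : T.Algebra} {g : (V ⊗ W) ⊙ₗ M.A ⟶ N.A}
    (hg : IsBalanced T (V ⊗ W) M N g) :
    IsBibalanced V W M N ((αₗ V W M.A).inv ≫ g) := by
  unfold IsBalanced at hg
  unfold IsBibalanced
  have e : V ⊴ₗ (W ⊴ₗ M.a) ≫ (αₗ V W M.A).inv = (αₗ V W _).inv ≫ (V ⊗ W) ⊴ₗ M.a := by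
    simp
  rw [← Category.assoc, e, Category.assoc, hg, T.map_comp, Category.assoc]
  rw [← μₗ_associativity_inv_assoc]

theorem IsBibalanced.balanced {V W : C} {M N : T.Algebra} {h : V ⊙ₗ (W ⊙ₗ M.A) ⟶ N.A}
    (hh : IsBibalanced V W M N h) :
    IsBalanced T (V ⊗ W) M N ((αₗ V W M.A).hom ≫ h) := by
  unfold IsBibalanced at hh
  unfold IsBalanced
  rw [T.map_comp, Category.assoc, μₗ_associativity_assoc, ← hh]
  simp

theorem IsBalanced.comp_balanced {V W : C} {M M' N : T.Algebra} {g : V ⊙ₗ M'.A ⟶ N.A}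
    (hg : IsBalanced T V M' N g) {g' : W ⊙ₗ M.A ⟶ M'.A} (hg' : IsBalanced T W M M' g') :
    IsBibalanced V W M N (V ⊴ₗ g' ≫ g) := by
  unfold IsBalanced at *
  unfold IsBibalanced
  rw [← Category.assoc, ← actionHomRight_comp, hg', actionHomRight_comp, actionHomRight_comp,
    Category.assoc, Category.assoc, hg, T.map_comp, μₗ_naturality_right_assoc, Category.assoc]

/-! ### Morphisms out of free algebras and their transposes. -/

theorem eta_comp_map_comp {X : D} {N : T.Algebra} (g : X ⟶ N.A) :
    T.η.app X ≫ T.map g ≫ N.a = g := by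
  refine (Monad.unit_naturality_assoc D T g N.a).symm.trans ?_
  rw [N.unit]
  exact Category.comp_id g

/-- The underlying morphism of an algebra morphism out of a free algebra. -/
def freeHom {X : D} {N : T.Algebra} (q : T.free.obj X ⟶ N) : T.obj X ⟶ N.A := q.f

theorem map_freeHom {X : D} {N : T.Algebra} (q : T.free.obj X ⟶ N) :
    T.map (freeHom q) ≫ N.a = T.μ.app X ≫ freeHom q := q.h

theorem map_eta_comp_freeHom {X : D} {N : T.Algebra} (q : T.free.obj X ⟶ N) :
    T.map (T.η.app X ≫ freeHom q) ≫ N.a = freeHom q := by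
  rw [T.map_comp, Category.assoc, map_freeHom, ← Category.assoc, T.right_unit]
  exact Category.id_comp _

theorem freeHom_ext {X : D} {N : T.Algebra} {q q' : T.free.obj X ⟶ N}
    (h : T.η.app X ≫ freeHom q = T.η.app X ≫ freeHom q') : q = q' := by
  apply Monad.Algebra.Hom.ext
  change freeHom q = freeHom q'
  rw [← map_eta_comp_freeHom q, ← map_eta_comp_freeHom q', h]

theorem freeHom_comp {X : D} {N N' : T.Algebra} (q : T.free.obj X ⟶ N) (f : N ⟶ N') :
    freeHom (q ≫ f) = freeHom q ≫ f.f := rfl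

theorem freeHom_free_map_comp {X Y : D} {N : T.Algebra} (g : X ⟶ Y) (q : T.free.obj Y ⟶ N) :
    freeHom (T.free.map g ≫ q) = T.map g ≫ freeHom q := rfl

/-- The algebra morphism `T X ⟶ N` determined by a morphism `X ⟶ N` of the base category. -/
def freeDesc {X : D} {N : T.Algebra} (g : X ⟶ N.A) : T.free.obj X ⟶ N where
  f := T.map g ≫ N.a
  h := by
    change T.map (T.map g ≫ N.a) ≫ N.a = T.μ.app X ≫ T.map g ≫ N.a
    rw [T.map_comp, Category.assoc, ← N.assoc, T.mu_naturality_assoc]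

theorem freeHom_freeDesc {X : D} {N : T.Algebra} (g : X ⟶ N.A) :
    freeHom (freeDesc g) = T.map g ≫ N.a := rfl

theorem eta_freeHom_freeDesc {X : D} {N : T.Algebra} (g : X ⟶ N.A) :
    T.η.app X ≫ freeHom (freeDesc g) = g :=
  eta_comp_map_comp g

-- Transposes of the two composites with the Linton pair: together with the next lemma, this turns
-- the coequalizing condition on `q` into balancedness of its transpose.
omit [LaxModuleMonad C T] in
theorem eta_freeHom_lintonFst_comp (V : C) (M : T.Algebra) {N : T.Algebra}
    (q : T.free.obj (V ⊙ₗ M.A) ⟶ N) :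
    T.η.app (V ⊙ₗ T.obj M.A) ≫ freeHom (lintonFst T V M ≫ q) =
      V ⊴ₗ M.a ≫ T.η.app (V ⊙ₗ M.A) ≫ freeHom q :=
  (Monad.unit_naturality_assoc D T (V ⊴ₗ M.a) (freeHom q)).symm

theorem eta_freeHom_lintonSnd_comp (V : C) (M : T.Algebra) {N : T.Algebra}
    (q : T.free.obj (V ⊙ₗ M.A) ⟶ N) :
    T.η.app (V ⊙ₗ T.obj M.A) ≫ freeHom (lintonSnd T V M ≫ q) =
      μₗ T.toFunctor V M.A ≫ freeHom q := by
  change T.η.app _ ≫ (T.map (μₗ T.toFunctor V M.A) ≫ T.μ.app (V ⊙ₗ M.A)) ≫ freeHom q = _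
  rw [Category.assoc, ← map_freeHom, ← T.map_comp_assoc, eta_comp_map_comp]

/-! ### The universal property of the Linton coequalizer, and the unitor. -/

section Coequalizer

variable [HasCoequalizers D] [PreservesFiniteColimits T.toFunctor]

/-- The underlying morphism of the quotient morphism `T (V ▷ M) ⟶ V ▶ M`. -/
noncomputable def lintonQuotHom (T : Monad D) [LaxModuleMonad C T]
    [PreservesFiniteColimits T.toFunctor] (V : C) (M : T.Algebra) :
    T.obj (V ⊙ₗ M.A) ⟶ (lintonObj T V M).A :=
  freeHom (lintonQuot T V M)

/-- The universal balanced morphism `V ▷ M ⟶ V ▶ M`. -/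
noncomputable def lintonProj (T : Monad D) [LaxModuleMonad C T]
    [PreservesFiniteColimits T.toFunctor] (V : C) (M : T.Algebra) :
    V ⊙ₗ M.A ⟶ (lintonObj T V M).A :=
  T.η.app (V ⊙ₗ M.A) ≫ lintonQuotHom T V M

theorem map_lintonQuotHom (V : C) (M : T.Algebra) :
    T.map (lintonQuotHom T V M) ≫ (lintonObj T V M).a =
      T.μ.app (V ⊙ₗ M.A) ≫ lintonQuotHom T V M :=
  map_freeHom (lintonQuot T V M)

theorem map_lintonProj (V : C) (M : T.Algebra) :
    T.map (lintonProj T V M) ≫ (lintonObj T V M).a = lintonQuotHom T V M :=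
  map_eta_comp_freeHom (lintonQuot T V M)

theorem lintonProj_balanced (V : C) (M : T.Algebra) :
    IsBalanced T V M (lintonObj T V M) (lintonProj T V M) := by
  have h := congrArg (fun q => T.η.app _ ≫ freeHom q) (lintonQuot_condition T V M)
  rw [eta_freeHom_lintonFst_comp, eta_freeHom_lintonSnd_comp] at h
  unfold IsBalanced
  rw [map_lintonProj]
  exact h

/-- The morphism `V ▶ M ⟶ N` induced by a balanced morphism `V ▷ M ⟶ N`. -/
noncomputable def lintonDesc {V : C} {M N : T.Algebra} (g : V ⊙ₗ M.A ⟶ N.A)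
    (hg : IsBalanced T V M N g) : lintonObj T V M ⟶ N :=
  coequalizer.desc (freeDesc g) (by
    -- Morphisms out of a free algebra are compared on η, where the coequalizing condition becomes
    -- the hypothesis `hg`.
    apply freeHom_ext
    rw [eta_freeHom_lintonFst_comp, eta_freeHom_lintonSnd_comp, eta_freeHom_freeDesc]
    exact hg)

theorem lintonProj_desc {V : C} {M N : T.Algebra} (g : V ⊙ₗ M.A ⟶ N.A)
    (hg : IsBalanced T V M N g) : lintonProj T V M ≫ (lintonDesc g hg).f = g := by
  have h : lintonQuot T V M ≫ lintonDesc g hg = freeDesc g := coequalizer.π_desc _ _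
  rw [lintonProj, lintonQuotHom, Category.assoc, ← freeHom_comp, h, eta_freeHom_freeDesc]

theorem lintonProj_desc_assoc {V : C} {M N : T.Algebra} (g : V ⊙ₗ M.A ⟶ N.A)
    (hg : IsBalanced T V M N g) {X : D} (f : N.A ⟶ X) :
    lintonProj T V M ≫ (lintonDesc g hg).f ≫ f = g ≫ f := by
  rw [← Category.assoc, lintonProj_desc]

/-- Only algebra morphisms are separated by π: it is the transpose of an epimorphism of `EM(T)`, and
is not claimed to be epi in `D`. -/
theorem lintonProj_hom_ext {V : C} {M N : T.Algebra} {f g : lintonObj T V M ⟶ N}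
    (h : lintonProj T V M ≫ f.f = lintonProj T V M ≫ g.f) : f = g := by
  apply lintonObj_hom_ext
  apply freeHom_ext
  rw [freeHom_comp, freeHom_comp]
  simpa [lintonProj, lintonQuotHom] using h

theorem lintonProj_map {V W : C} {M N : T.Algebra} (f : V ⟶ W) (g : M ⟶ N) :
    lintonProj T V M ≫ (lintonMap T f g).f = (f ⊙ₗₘ g.f) ≫ lintonProj T W N := by
  rw [lintonProj, lintonQuotHom, Category.assoc, ← freeHom_comp, lintonQuot_map,
    freeHom_free_map_comp]
  exact (Monad.unit_naturality_assoc D T (f ⊙ₗₘ g.f) _).symm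

theorem lintonProj_map_assoc {V W : C} {M N : T.Algebra} (f : V ⟶ W) (g : M ⟶ N) {X : D}
    (h : (lintonObj T W N).A ⟶ X) :
    lintonProj T V M ≫ (lintonMap T f g).f ≫ h = (f ⊙ₗₘ g.f) ≫ lintonProj T W N ≫ h := by
  rw [← Category.assoc, lintonProj_map, Category.assoc]

/-- The associator of the action by Linton coequalizers, as a morphism. -/
noncomputable def lintonAssoc (V W : C) (M : T.Algebra) :
    lintonObj T (V ⊗ W) M ⟶ lintonObj T V (lintonObj T W M) :=
  lintonDesc ((αₗ V W M.A).hom ≫ V ⊴ₗ lintonProj T W M ≫ lintonProj T V (lintonObj T W M))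
    ((lintonProj_balanced V (lintonObj T W M)).comp_balanced (lintonProj_balanced W M)).balanced

theorem lintonProj_assoc (V W : C) (M : T.Algebra) :
    lintonProj T (V ⊗ W) M ≫ (lintonAssoc V W M).f =
      (αₗ V W M.A).hom ≫ V ⊴ₗ lintonProj T W M ≫ lintonProj T V (lintonObj T W M) :=
  lintonProj_desc _ _

theorem lintonProj_assoc_assoc (V W : C) (M : T.Algebra) {X : D}
    (f : (lintonObj T V (lintonObj T W M)).A ⟶ X) :
    lintonProj T (V ⊗ W) M ≫ (lintonAssoc V W M).f ≫ f =
      (αₗ V W M.A).hom ≫ V ⊴ₗ lintonProj T W M ≫ lintonProj T V (lintonObj T W M) ≫ f := by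
  rw [← Category.assoc, lintonProj_assoc, Category.assoc, Category.assoc]

/-- Balancedness of π at `V = 𝟙_ C`, read through `λₗ`, says that the candidate inverse of the
unitor is an algebra morphism. -/
theorem map_unit_inv_comp_lintonProj (M : T.Algebra) :
    T.map ((λₗ[C] M.A).inv ≫ lintonProj T (𝟙_ C) M) ≫ (lintonObj T (𝟙_ C) M).a =
      M.a ≫ (λₗ[C] M.A).inv ≫ lintonProj T (𝟙_ C) M := by
  have h := lintonProj_balanced (𝟙_ C) M
  unfold IsBalanced at h
  rw [← actionUnitIso_inv_naturality_assoc, h, ← Category.assoc (λₗ _).inv, μₗ_unitality_inv,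
    ← T.map_comp_assoc]

/-- The unitor of the action by Linton coequalizers. -/
@[simps]
noncomputable def lintonUnitIso (M : T.Algebra) : lintonObj T (𝟙_ C) M ≅ M where
  hom := lintonDesc (λₗ M.A).hom (isBalanced_unit M)
  inv :=
    { f := (λₗ M.A).inv ≫ lintonProj T (𝟙_ C) M
      h := map_unit_inv_comp_lintonProj M }
  hom_inv_id := by
    apply lintonProj_hom_ext
    rw [Monad.Algebra.comp_f, lintonProj_desc_assoc]
    simp
  inv_hom_id := by
    ext
    simp [lintonProj_desc]

/-! ### Iterated Linton coequalizers and the associator. -/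

variable [∀ V : C, PreservesFiniteColimits (actionLeft D V)]

/-- The forgetful functor preserves coequalizers because `T` does, and so does `V ▷ -`; the image of
the quotient morphism is therefore still a coequalizer. -/
instance epi_actionHomRight_lintonQuotHom (V W : C) (M : T.Algebra) :
    Epi (V ⊴ₗ lintonQuotHom T W M) := by
  have : PreservesColimitsOfShape WalkingParallelPair T.forget := inferInstance
  have := Cofork.IsColimit.epi (isColimitOfHasCoequalizerOfPreservesColimit
    (T.forget ⋙ actionLeft D V) (lintonFst T W M) (lintonSnd T W M))
  exact this

instance epi_actionHomRight_map_lintonQuotHom (V W : C) (M : T.Algebra) :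
    Epi (V ⊴ₗ T.map (lintonQuotHom T W M)) := by
  have := Cofork.IsColimit.epi (isColimitOfHasCoequalizerOfPreservesColimit
    (T.forget ⋙ T.toFunctor ⋙ actionLeft D V) (lintonFst T W M) (lintonSnd T W M))
  exact this

/-- The action of `V` preserves the Linton coequalizer `W ▶ M`, so that a bibalanced morphism
`V ▷ (W ▷ M) ⟶ N` extends along `V ▷ T (W ▷ M) ⟶ V ▷ (W ▶ M)`. -/
theorem IsBibalanced.exists_extension {V W : C} {M N : T.Algebra} {h : V ⊙ₗ (W ⊙ₗ M.A) ⟶ N.A}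
    (hh : IsBibalanced V W M N h) :
    ∃ g : V ⊙ₗ (lintonObj T W M).A ⟶ N.A,
      V ⊴ₗ lintonQuotHom T W M ≫ g = μₗ T.toFunctor V (W ⊙ₗ M.A) ≫ T.map h ≫ N.a := by
  let c := isColimitOfHasCoequalizerOfPreservesColimit
    (T.forget ⋙ actionLeft D V) (lintonFst T W M) (lintonSnd T W M)
  -- The morphism to be extended is the only possible one: a balanced extension of `h` must restrict
  -- to it on `V ▷ T (W ▷ M)`.
  refine ⟨Cofork.IsColimit.desc c (μₗ T.toFunctor V (W ⊙ₗ M.A) ≫ T.map h ≫ N.a) ?_,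
    Cofork.IsColimit.π_desc' c _ _⟩
  change V ⊴ₗ T.map (W ⊴ₗ M.a) ≫ μₗ T.toFunctor V _ ≫ T.map h ≫ N.a =
    V ⊴ₗ (T.map (μₗ T.toFunctor W M.A) ≫ T.μ.app _) ≫ μₗ T.toFunctor V _ ≫ T.map h ≫ N.a
  unfold IsBibalanced at hh
  -- Bibalancedness of `h` rewrites the first leg; the multiplication axiom for the lax structure
  -- and associativity of `N` bring the second to the same form.
  rw [actionHomRight_comp, Category.assoc, μₗ_naturality_right_assoc, ← T.map_comp_assoc, hh,
    ← Category.assoc (V ⊴ₗ T.μ.app _), LaxModuleMonad.mul_transformation]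
  simp only [T.map_comp, Category.assoc, μₗ_naturality_right_assoc]
  rw [← N.assoc, ← T.mu_naturality_assoc]

/-- The extension to `V ▷ (W ▶ M)` is again balanced, so it descends once more. This is the
existence half of the universal property of `V ▶ (W ▶ M)` for bibalanced morphisms. -/
theorem IsBibalanced.exists_desc {V W : C} {M N : T.Algebra} {h : V ⊙ₗ (W ⊙ₗ M.A) ⟶ N.A}
    (hh : IsBibalanced V W M N h) :
    ∃ f : lintonObj T V (lintonObj T W M) ⟶ N,
      V ⊴ₗ lintonProj T W M ≫ lintonProj T V (lintonObj T W M) ≫ f.f = h := by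
  obtain ⟨g, hg⟩ := hh.exists_extension
  have hb : IsBalanced T V (lintonObj T W M) N g := by
    unfold IsBalanced
    -- Balancedness is an equation on `V ▷ T (W ▶ M)`; it is tested on `V ▷ T T (W ▷ M)`, where `g`
    -- is known explicitly.
    rw [← cancel_epi (V ⊴ₗ T.map (lintonQuotHom T W M)), ← actionHomRight_comp_assoc, map_lintonQuotHom,
      actionHomRight_comp, Category.assoc, hg, μₗ_naturality_right_assoc, ← T.map_comp_assoc, hg,
      ← Category.assoc (V ⊴ₗ T.μ.app _), LaxModuleMonad.mul_transformation]
    simp only [T.map_comp, Category.assoc]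
    rw [← N.assoc, ← T.mu_naturality_assoc]
  refine ⟨lintonDesc g hb, ?_⟩
  rw [lintonProj_desc, lintonProj, actionHomRight_comp, Category.assoc, hg,
    ← Category.assoc, LaxModuleMonad.unit_transformation, eta_comp_map_comp]

/-- Morphisms out of `V ▶ (W ▶ M)` are determined by their restriction to `V ▷ (W ▷ M)`. -/
theorem lintonProj_lintonProj_hom_ext {V W : C} {M N : T.Algebra}
    {f g : lintonObj T V (lintonObj T W M) ⟶ N}
    (h : V ⊴ₗ lintonProj T W M ≫ lintonProj T V (lintonObj T W M) ≫ f.f =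
      V ⊴ₗ lintonProj T W M ≫ lintonProj T V (lintonObj T W M) ≫ g.f) : f = g := by
  have key (f : lintonObj T V (lintonObj T W M) ⟶ N) :
      V ⊴ₗ lintonQuotHom T W M ≫ lintonProj T V (lintonObj T W M) ≫ f.f =
        μₗ T.toFunctor V (W ⊙ₗ M.A) ≫
          T.map (V ⊴ₗ lintonProj T W M ≫ lintonProj T V (lintonObj T W M) ≫ f.f) ≫ N.a := by
    -- The quotient morphism is `T π` followed by the action of `W ▶ M`, and balancedness moves that
    -- action past the outer π.
    have hb := (lintonProj_balanced V (lintonObj T W M)).comp f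
    unfold IsBalanced at hb
    rw [← map_lintonProj, actionHomRight_comp, Category.assoc, hb]
    simp
  apply lintonProj_hom_ext
  rw [← cancel_epi (V ⊴ₗ lintonQuotHom T W M), key f, key g, h]

/-- The inverse of `lintonAssoc`. -/
noncomputable def lintonAssocInv (V W : C) (M : T.Algebra) :
    lintonObj T V (lintonObj T W M) ⟶ lintonObj T (V ⊗ W) M :=
  (lintonProj_balanced (V ⊗ W) M).bibalanced.exists_desc.choose

theorem lintonProj_assocInv (V W : C) (M : T.Algebra) :
    V ⊴ₗ lintonProj T W M ≫ lintonProj T V (lintonObj T W M) ≫ (lintonAssocInv V W M).f =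
      (αₗ V W M.A).inv ≫ lintonProj T (V ⊗ W) M :=
  (lintonProj_balanced (V ⊗ W) M).bibalanced.exists_desc.choose_spec

theorem lintonProj_assocInv_assoc (V W : C) (M : T.Algebra) {X : D}
    (f : (lintonObj T (V ⊗ W) M).A ⟶ X) :
    V ⊴ₗ lintonProj T W M ≫ lintonProj T V (lintonObj T W M) ≫ (lintonAssocInv V W M).f ≫ f =
      (αₗ V W M.A).inv ≫ lintonProj T (V ⊗ W) M ≫ f := by
  have h := congrArg (· ≫ f) (lintonProj_assocInv V W M)
  simpa only [Category.assoc] using h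

/-- The associator of the action by Linton coequalizers. -/
@[simps]
noncomputable def lintonAssocIso (V W : C) (M : T.Algebra) :
    lintonObj T (V ⊗ W) M ≅ lintonObj T V (lintonObj T W M) where
  hom := lintonAssoc V W M
  inv := lintonAssocInv V W M
  hom_inv_id := by
    apply lintonProj_hom_ext
    simp [lintonProj_assoc_assoc, lintonProj_assocInv]
  inv_hom_id := by
    apply lintonProj_lintonProj_hom_ext
    simp [lintonProj_assoc, lintonProj_assocInv_assoc]

end Coequalizer
end Balanced

/-! ### Naturality and coherence, tested on π. -/

section ModuleCategory

variable {C : Type u₁} [Category.{v₁} C] [MonoidalCategory C]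
  {D : Type u₂} [Category.{v₂} D] [MonoidalLeftAction C D]
  {T : Monad D} [LaxModuleMonad C T] [HasCoequalizers D] [PreservesFiniteColimits T.toFunctor]

open Functor.LaxLeftLinear

theorem lintonProj_map_left {V W : C} (f : V ⟶ W) (M : T.Algebra) :
    lintonProj T V M ≫ (lintonMap T f (𝟙 M)).f = f ⊵ₗ M.A ≫ lintonProj T W M := by
  rw [lintonProj_map, Monad.Algebra.id_f, actionHom_id]

theorem lintonProj_map_right (V : C) {M N : T.Algebra} (g : M ⟶ N) :
    lintonProj T V M ≫ (lintonMap T (𝟙 V) g).f = V ⊴ₗ g.f ≫ lintonProj T V N := by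
  rw [lintonProj_map, id_actionHom]

theorem lintonProj_map_left_assoc {V W : C} (f : V ⟶ W) (M : T.Algebra) {X : D}
    (h : (lintonObj T W M).A ⟶ X) :
    lintonProj T V M ≫ (lintonMap T f (𝟙 M)).f ≫ h = f ⊵ₗ M.A ≫ lintonProj T W M ≫ h := by
  rw [← Category.assoc, lintonProj_map_left, Category.assoc]

theorem lintonProj_map_right_assoc (V : C) {M N : T.Algebra} (g : M ⟶ N) {X : D}
    (h : (lintonObj T V N).A ⟶ X) :
    lintonProj T V M ≫ (lintonMap T (𝟙 V) g).f ≫ h = V ⊴ₗ g.f ≫ lintonProj T V N ≫ h := by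
  rw [← Category.assoc, lintonProj_map_right, Category.assoc]

theorem lintonAssoc_naturality {V V' W W' : C} {M N : T.Algebra} (f : V ⟶ V') (g : W ⟶ W')
    (h : M ⟶ N) :
    lintonMap T (f ⊗ₘ g) h ≫ lintonAssoc V' W' N =
      lintonAssoc V W M ≫ lintonMap T f (lintonMap T g h) := by
  apply lintonProj_hom_ext
  have e : V ⊴ₗ lintonProj T W M ≫ (f ⊙ₗₘ (lintonMap T g h).f) =
      (f ⊙ₗₘ g ⊙ₗₘ h.f) ≫ V' ⊴ₗ lintonProj T W' N := by
    rw [← id_actionHom, ← id_actionHom, ← actionHom_comp, ← actionHom_comp, lintonProj_map,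
      Category.id_comp, Category.comp_id]
  rw [Monad.Algebra.comp_f, Monad.Algebra.comp_f, lintonProj_map_assoc, lintonProj_assoc,
    lintonProj_assoc_assoc, lintonProj_map, ← Category.assoc (V ⊴ₗ _), e, Category.assoc,
    actionAssocIso_hom_naturality_assoc]

theorem lintonUnitIso_naturality {M N : T.Algebra} (f : M ⟶ N) :
    (lintonUnitIso (C := C) M).hom ≫ f = lintonMap T (𝟙 (𝟙_ C)) f ≫ (lintonUnitIso N).hom := by
  apply lintonProj_hom_ext
  rw [Monad.Algebra.comp_f, Monad.Algebra.comp_f, lintonUnitIso_hom, lintonUnitIso_hom,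
    lintonProj_desc_assoc, lintonProj_map_right_assoc, lintonProj_desc,
    actionUnitIso_hom_naturality]

/-- After π, every associator becomes `αₗ` followed by projections, leaving the pentagon of `D`. -/
theorem lintonAssoc_pentagon (U V W : C) (M : T.Algebra) :
    lintonMap T (α_ U V W).hom (𝟙 M) ≫ lintonAssoc U (V ⊗ W) M ≫
        lintonMap T (𝟙 U) (lintonAssoc V W M) =
      lintonAssoc (U ⊗ V) W M ≫ lintonAssoc U V (lintonObj T W M) := by
  apply lintonProj_hom_ext
  simp only [Monad.Algebra.comp_f, lintonProj_map_left_assoc, lintonProj_assoc_assoc,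
    lintonProj_map_right, lintonProj_assoc, ← actionHomRight_comp_assoc]
  simp

theorem lintonAssoc_left_triangle (V : C) (M : T.Algebra) :
    lintonMap T (λ_ V).hom (𝟙 M) =
      lintonAssoc (𝟙_ C) V M ≫ (lintonUnitIso (lintonObj T V M)).hom := by
  apply lintonProj_hom_ext
  rw [Monad.Algebra.comp_f, lintonProj_map_left, lintonProj_assoc_assoc, lintonUnitIso_hom,
    lintonProj_desc]
  simp

theorem lintonAssoc_right_triangle (V : C) (M : T.Algebra) :
    lintonMap T (ρ_ V).hom (𝟙 M) =
      lintonAssoc V (𝟙_ C) M ≫ lintonMap T (𝟙 V) (lintonUnitIso M).hom := by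
  apply lintonProj_hom_ext
  rw [Monad.Algebra.comp_f, lintonProj_map_left, lintonProj_assoc_assoc, lintonUnitIso_hom,
    lintonProj_map_right, ← actionHomRight_comp_assoc, lintonProj_desc]
  simp

variable (C T) in
/-- The module structure on the Eilenberg–Moore category given by Linton coequalizers. -/
noncomputable def lintonModuleStructure [∀ V : C, PreservesFiniteColimits (actionLeft D V)] :
    ModuleStructure (lintonAction C T) where
  assocIso := lintonAssocIso
  unitIso := lintonUnitIso
  assoc_naturality {V V' W W' M N} f g h := by
    change (lintonMap T (f ⊗ₘ g) (𝟙 M) ≫ lintonMap T (𝟙 (V' ⊗ W')) h) ≫ lintonAssoc V' W' N =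
      lintonAssoc V W M ≫ lintonMap T f (𝟙 (lintonObj T W M)) ≫
        lintonMap T (𝟙 V') (lintonMap T g (𝟙 M) ≫ lintonMap T (𝟙 W') h)
    simp only [← lintonMap_comp, Category.id_comp, Category.comp_id]
    exact lintonAssoc_naturality f g h
  unit_naturality := lintonUnitIso_naturality
  pentagon := lintonAssoc_pentagon
  left_triangle := lintonAssoc_left_triangle
  right_triangle := lintonAssoc_right_triangle

/-! ### The action on free algebras. -/

variable (T) in
/-- The lax structure morphism, between the underlying objects of free algebras. -/
def freeLax (V : C) (X : D) : V ⊙ₗ (T.free.obj X).A ⟶ (T.free.obj (V ⊙ₗ X)).A :=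
  μₗ T.toFunctor V X

variable (T) in
/-- The comparison morphism `V ▶ T X ⟶ T (V ▷ X)` of free algebras. -/
noncomputable def lintonFree (V : C) (X : D) :
    lintonObj T V (T.free.obj X) ⟶ T.free.obj (V ⊙ₗ X) :=
  lintonDesc (freeLax T V X) (isBalanced_lax V X)

theorem lintonProj_lintonFree (V : C) (X : D) :
    lintonProj T V (T.free.obj X) ≫ (lintonFree T V X).f = freeLax T V X :=
  lintonProj_desc _ _

theorem lintonProj_lintonFree_assoc (V : C) (X : D) {Y : D} (f : (T.free.obj (V ⊙ₗ X)).A ⟶ Y) :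
    lintonProj T V (T.free.obj X) ≫ (lintonFree T V X).f ≫ f = freeLax T V X ≫ f :=
  lintonProj_desc_assoc _ _ _

variable (T) in
/-- The universal balanced morphism `V ▷ T X ⟶ V ▶ T X` of a free algebra. -/
noncomputable def lintonProjFree (V : C) (X : D) :
    V ⊙ₗ T.obj X ⟶ (lintonObj T V (T.free.obj X)).A :=
  lintonProj T V (T.free.obj X)

theorem lintonProjFree_comp_lintonFree (V : C) (X : D) :
    lintonProjFree T V X ≫ (lintonFree T V X).f = μₗ T.toFunctor V X :=
  lintonProj_desc _ _

/-- A balanced morphism on `V ▷ T X` is recovered from its restriction along `V ▷ η_X`, since `T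
η_X` followed by `μ_X` is the identity. For π this gives one of the two inverse laws of
`lintonFreeIso`. -/
theorem lintonProjFree_eq (V : C) (X : D) :
    lintonProjFree T V X =
      μₗ T.toFunctor V X ≫ T.map (V ⊴ₗ T.η.app X ≫ lintonProjFree T V X) ≫
        (lintonObj T V (T.free.obj X)).a := by
  have h : V ⊴ₗ T.μ.app X ≫ lintonProjFree T V X =
      μₗ T.toFunctor V (T.obj X) ≫ T.map (lintonProjFree T V X) ≫
        (lintonObj T V (T.free.obj X)).a :=
    lintonProj_balanced (T := T) V (T.free.obj X)
  rw [T.map_comp_assoc, ← μₗ_naturality_right_assoc, ← h, ← actionHomRight_comp_assoc,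
    T.right_unit]
  exact ((congrArg (· ≫ _) (actionHomRight_id V _)).trans (Category.id_comp _)).symm

/-- The isomorphism `V ▶ T X ≅ T (V ▷ X)` of free algebras. -/
noncomputable def lintonFreeIso (V : C) (X : D) :
    lintonObj T V (T.free.obj X) ≅ T.free.obj (V ⊙ₗ X) where
  hom := lintonFree T V X
  inv := freeDesc (V ⊴ₗ T.η.app X ≫ lintonProjFree T V X)
  hom_inv_id := by
    apply lintonProj_hom_ext
    change lintonProjFree T V X ≫ (lintonFree T V X).f ≫ freeHom (freeDesc _) =
      lintonProjFree T V X ≫ 𝟙 _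
    have h := congrArg (· ≫ freeHom (freeDesc (V ⊴ₗ T.η.app X ≫ lintonProjFree T V X)))
      (lintonProjFree_comp_lintonFree (T := T) V X)
    refine (Category.assoc _ _ _).symm.trans (h.trans ?_)
    rw [freeHom_freeDesc, Category.comp_id, ← lintonProjFree_eq]
  inv_hom_id := by
    apply freeHom_ext
    rw [freeHom_comp, ← Category.assoc, eta_freeHom_freeDesc]
    refine (Category.assoc _ _ _).trans ?_
    refine (congrArg (V ⊴ₗ T.η.app X ≫ ·) (lintonProjFree_comp_lintonFree V X)).trans ?_
    exact (LaxModuleMonad.unit_transformation V X).trans (Category.comp_id _).symm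

theorem lintonFree_naturality_left {V W : C} (f : V ⟶ W) (X : D) :
    lintonMap T f (𝟙 (T.free.obj X)) ≫ lintonFree T W X =
      lintonFree T V X ≫ T.free.map (f ⊵ₗ X) := by
  apply lintonProj_hom_ext
  rw [Monad.Algebra.comp_f, Monad.Algebra.comp_f, lintonProj_map_left_assoc, lintonProj_lintonFree,
    lintonProj_lintonFree_assoc]
  exact μₗ_naturality_left T.toFunctor f X

/-- The two `freeDesc` terms are the images under ι of the Kleisli morphism `g` and of its translate
by `V`. On π the identity reduces to naturality of the lax structure and its compatibility with `μ`.
-/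
theorem lintonFree_naturality_right (V : C) {X Y : D} (g : X ⟶ T.obj Y) :
    lintonMap T (𝟙 V) (freeDesc (N := T.free.obj Y) g) ≫ lintonFree T V Y =
      lintonFree T V X ≫
        freeDesc (N := T.free.obj (V ⊙ₗ Y)) (V ⊴ₗ g ≫ μₗ T.toFunctor V Y) := by
  apply lintonProj_hom_ext
  rw [Monad.Algebra.comp_f, Monad.Algebra.comp_f, lintonProj_map_right_assoc, lintonProj_lintonFree,
    lintonProj_lintonFree_assoc]
  change V ⊴ₗ (T.map g ≫ T.μ.app Y) ≫ μₗ T.toFunctor V Y =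
    μₗ T.toFunctor V X ≫ T.map (V ⊴ₗ g ≫ μₗ T.toFunctor V Y) ≫ T.μ.app (V ⊙ₗ Y)
  rw [actionHomRight_comp, Category.assoc, LaxModuleMonad.mul_transformation,
    μₗ_naturality_right_assoc, T.map_comp, Category.assoc]

theorem lintonFree_associativity (V W : C) (X : D) :
    lintonFree T (V ⊗ W) X ≫ T.free.map (αₗ V W X).hom =
      lintonAssoc V W (T.free.obj X) ≫ lintonMap T (𝟙 V) (lintonFree T W X) ≫
        lintonFree T V (W ⊙ₗ X) := by
  apply lintonProj_hom_ext
  rw [Monad.Algebra.comp_f, Monad.Algebra.comp_f, Monad.Algebra.comp_f, lintonProj_assoc_assoc,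
    lintonProj_map_right_assoc, ← actionHomRight_comp_assoc, lintonProj_lintonFree, lintonProj_lintonFree,
    lintonProj_lintonFree_assoc]
  exact μₗ_associativity T.toFunctor V W X

theorem lintonFree_unitality (X : D) :
    (lintonUnitIso (C := C) (T.free.obj X)).hom =
      lintonFree T (𝟙_ C) X ≫ T.free.map (λₗ X).hom := by
  apply lintonProj_hom_ext
  rw [Monad.Algebra.comp_f, lintonUnitIso_hom, lintonProj_desc, lintonProj_lintonFree_assoc]
  exact μₗ_unitality T.toFunctor X

omit [HasCoequalizers D] [PreservesFiniteColimits T.toFunctor] in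
theorem kleisliInclusion_map_kleisliPure {X Y : D} (f : X ⟶ Y) :
    (kleisliInclusion T).map (kleisliPure T f) = T.free.map f := by
  ext
  change T.map (f ≫ T.η.app Y) ≫ T.μ.app Y = T.map f
  rw [T.map_comp, Category.assoc, T.right_unit]
  exact Category.comp_id _

end ModuleCategory

/-! ### The Kleisli inclusion as a strong module functor. -/

/-- A lax left linear functor whose structure morphisms are invertible is left linear. -/
@[reducible]
def leftLinearOfIso {C : Type u₁} [Category.{v₁} C] [MonoidalCategory C]
    {D : Type*} [Category* D] [MonoidalLeftAction C D] {D' : Type*} [Category* D']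
    [MonoidalLeftAction C D'] (F : D ⥤ D') [L : F.LaxLeftLinear C]
    (e : ∀ (c : C) (d : D), c ⊙ₗ F.obj d ≅ F.obj (c ⊙ₗ d))
    (he : ∀ (c : C) (d : D), (e c d).hom = Functor.LaxLeftLinear.μₗ F c d) : F.LeftLinear C where
  toLaxLeftLinear := L
  δₗ c d := (e c d).inv
  δₗ_naturality_left f d := by
    rw [Iso.eq_inv_comp, ← Category.assoc, Iso.comp_inv_eq, he, he]
    exact (Functor.LaxLeftLinear.μₗ_naturality_left F f d).symm
  δₗ_naturality_right c _ _ f := by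
    rw [Iso.eq_inv_comp, ← Category.assoc, Iso.comp_inv_eq, he, he]
    exact (Functor.LaxLeftLinear.μₗ_naturality_right F c f).symm
  δₗ_associativity c c' d := by
    rw [← cancel_epi (e (c ⊗ c') d).hom, Iso.hom_inv_id_assoc, he,
      Functor.LaxLeftLinear.μₗ_associativity_assoc, ← he, ← he, Iso.hom_inv_id_assoc]
    simp
  δₗ_unitality_inv d := by
    rw [Iso.eq_comp_inv, he, Functor.LaxLeftLinear.μₗ_unitality_inv]
  μₗ_comp_δₗ c d := by rw [← he, Iso.hom_inv_id]
  δₗ_comp_μₗ c d := by rw [← he, Iso.inv_hom_id]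

section KleisliInclusion

variable {C : Type u₁} [Category.{v₁} C] [MonoidalCategory C]
  {D : Type u₂} [Category.{v₂} D] [MonoidalLeftAction C D]
  (T : Monad D) [LaxModuleMonad C T] [HasCoequalizers D] [PreservesFiniteColimits T.toFunctor]
  [∀ V : C, PreservesFiniteColimits (actionLeft D V)]

/-- The inclusion of the Kleisli category into the Eilenberg–Moore category is a strong module
functor. -/
@[reducible]
noncomputable def kleisliInclusionLeftLinear :
    letI : MonoidalLeftAction C T.Algebra := (lintonModuleStructure C T).toAction
    (kleisliInclusion T).LeftLinear C :=
  letI : MonoidalLeftAction C T.Algebra := (lintonModuleStructure C T).toAction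
  letI : (kleisliInclusion T).LaxLeftLinear C :=
    { μₗ V X := lintonFree T V X.of
      -- Structure morphisms of the Kleisli category come from `D`, so ι sends them to free
      -- morphisms and the identities for free algebras apply.
      μₗ_naturality_left f X :=
        (lintonFree_naturality_left f X.of).trans
          (congrArg (lintonFree T _ X.of ≫ ·) (kleisliInclusion_map_kleisliPure _).symm)
      μₗ_naturality_right V _ _ g := lintonFree_naturality_right V g.of
      μₗ_associativity V W X :=
        (congrArg (lintonFree T _ X.of ≫ ·) (kleisliInclusion_map_kleisliPure _)).trans
          (lintonFree_associativity V W X.of)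
      μₗ_unitality X :=
        (lintonFree_unitality X.of).trans
          (congrArg (lintonFree T _ X.of ≫ ·) (kleisliInclusion_map_kleisliPure _).symm) }
  leftLinearOfIso (kleisliInclusion T) (fun V X => lintonFreeIso V X.of) fun _ _ => rfl

end KleisliInclusion

/-! ### Linearity, inherited from the action on `D` by restriction along π. -/

section Linearity

variable (k : Type w) [Field k]
  {C : Type u₁} [Category.{v₁} C] [Preadditive C] [Linear k C] [MonoidalCategory C]
  {D : Type u₂} [Category.{v₂} D] [Preadditive D] [Linear k D] [MonoidalLeftAction C D]
  (T : Monad D) [T.toFunctor.Additive]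

instance kleisliInclusion_additive : (kleisliInclusion T).Additive where
  map_add {X Y f g} := by
    ext
    change T.map (f.of + g.of) ≫ T.μ.app Y.of =
      T.map f.of ≫ T.μ.app Y.of + T.map g.of ≫ T.μ.app Y.of
    rw [T.map_add, Preadditive.add_comp]

instance kleisliInclusion_linear [T.toFunctor.Linear k] : (kleisliInclusion T).Linear k where
  map_smul {X Y} f r := by
    ext
    change T.map (r • f.of) ≫ T.μ.app Y.of = r • (T.map f.of ≫ T.μ.app Y.of)
    rw [T.map_smul, Linear.smul_comp]

variable [HasCoequalizers D] [PreservesFiniteColimits T.toFunctor] [LaxModuleMonad C T]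

instance lintonAction_obj_additive (V : C) [(actionLeft D V).Additive] :
    ((lintonAction C T).obj V).Additive where
  map_add {M N f g} := by
    apply lintonProj_hom_ext
    change lintonProj T V M ≫ (lintonMap T (𝟙 V) (f + g)).f =
      lintonProj T V M ≫ ((lintonMap T (𝟙 V) f).f + (lintonMap T (𝟙 V) g).f)
    rw [Preadditive.comp_add, lintonProj_map_right, lintonProj_map_right, lintonProj_map_right,
      ← Preadditive.add_comp]
    exact congrArg (· ≫ _) ((actionLeft D V).map_add (f := f.f) (g := g.f))

instance lintonAction_obj_linear [T.toFunctor.Linear k] (V : C) [(actionLeft D V).Linear k] :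
    ((lintonAction C T).obj V).Linear k where
  map_smul {M N} f r := by
    apply lintonProj_hom_ext
    change lintonProj T V M ≫ (lintonMap T (𝟙 V) (r • f)).f =
      lintonProj T V M ≫ (r • (lintonMap T (𝟙 V) f).f)
    rw [Linear.comp_smul, lintonProj_map_right, lintonProj_map_right, ← Linear.smul_comp]
    exact congrArg (· ≫ _) ((actionLeft D V).map_smul r f.f)

instance lintonAction_flip_obj_additive (M : T.Algebra) [(actionRight C M.A).Additive] :
    ((lintonAction C T).flip.obj M).Additive where
  map_add {V W f g} := by
    apply lintonProj_hom_ext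
    change lintonProj T V M ≫ (lintonMap T (f + g) (𝟙 M)).f =
      lintonProj T V M ≫ ((lintonMap T f (𝟙 M)).f + (lintonMap T g (𝟙 M)).f)
    rw [Preadditive.comp_add, lintonProj_map_left, lintonProj_map_left, lintonProj_map_left,
      ← Preadditive.add_comp]
    exact congrArg (· ≫ _) ((actionRight C M.A).map_add (f := f) (g := g))

instance lintonAction_flip_obj_linear [T.toFunctor.Linear k] (M : T.Algebra)
    [(actionRight C M.A).Linear k] : ((lintonAction C T).flip.obj M).Linear k where
  map_smul {V W} f r := by
    apply lintonProj_hom_ext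
    change lintonProj T V M ≫ (lintonMap T (r • f) (𝟙 M)).f =
      lintonProj T V M ≫ (r • (lintonMap T f (𝟙 M)).f)
    rw [Linear.comp_smul, lintonProj_map_left, lintonProj_map_left, ← Linear.smul_comp]
    exact congrArg (· ≫ _) ((actionRight C M.A).map_smul r f)

end Linearity

theorem theorem3p24
    (k : Type w) [Field k]
    {C : Type u₁} [Category.{v₁} C] [Abelian C] [Linear k C]
    [MonoidalCategory C] [MonoidalPreadditive C] [MonoidalLinear k C]
    {D : Type u₂} [Category.{v₂} D] [Abelian D] [Linear k D] [MonoidalLeftAction C D]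
    [∀ V : C, (actionLeft D V).Additive] [∀ V : C, (actionLeft D V).Linear k]
    [∀ M : D, (actionRight C M).Additive] [∀ M : D, (actionRight C M).Linear k]
    [∀ V : C, PreservesFiniteColimits (actionLeft D V)]
    [∀ M : D, PreservesFiniteColimits (actionRight C M)]
    (T : Monad D) [T.toFunctor.Additive] [T.toFunctor.Linear k]
    [PreservesFiniteColimits T.toFunctor] [LaxModuleMonad C T] :
    (∀ V : C, ((lintonAction C T).obj V).Additive ∧ ((lintonAction C T).obj V).Linear k) ∧
    (∀ M : T.Algebra, ((lintonAction C T).flip.obj M).Additive ∧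
      ((lintonAction C T).flip.obj M).Linear k) ∧
    (kleisliInclusion T).Additive ∧ (kleisliInclusion T).Linear k ∧
    ∃ S : ModuleStructure (lintonAction C T),
      (∀ (V W : C) (M : T.Algebra),
        lintonUnit T (V ⊗ W) M ≫ (S.assocIso V W M).hom.f =
          (αₗ V W M.A).hom ≫ V ⊴ₗ lintonUnit T W M ≫
            lintonUnit T V (((lintonAction C T).obj W).obj M)) ∧
      (∀ M : T.Algebra, lintonUnit T (𝟙_ C) M ≫ (S.unitIso M).hom.f = (λₗ M.A).hom) ∧
      letI : MonoidalLeftAction C T.Algebra := S.toAction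
      ∃ L : (kleisliInclusion T).LeftLinear C,
        ∀ (V : C) (X : Kleisli T),
          lintonUnit T V ((kleisliInclusion T).obj X) ≫ (L.μₗ V X).f =
            Functor.LaxLeftLinear.μₗ T.toFunctor V X.of :=
  -- `lintonUnit` and `lintonProj` agree definitionally, so the compatibilities with π are the
  -- equations characterising the induced morphisms.
  ⟨fun _ => ⟨inferInstance, inferInstance⟩, fun _ => ⟨inferInstance, inferInstance⟩,
    inferInstance, inferInstance, lintonModuleStructure C T, lintonProj_assoc,
    fun M => lintonProj_desc _ (isBalanced_unit M), kleisliInclusionLeftLinear T,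
    fun V X => lintonProjFree_comp_lintonFree V X.of⟩
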